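/- Let $\mathtt A$ be a countably infinite set of atomic types, ranged over by $\varphi$, and let $\omega\notin\mathtt A$. Types are generated by $\sigma ::= \varphi \mid \omega \mid \sigma\to\sigma \mid \sigma\wedge\sigma \mid \sigma\vee\sigma$ ($\wedge,\vee$ bind more tightly than $\to$). A type context $C[\ ]$ is a type with exactly one hole. *Semantic equivalence* $\simeq$ is the least congruence on types (with respect to $\to,\wedge,\vee$) such that, for all $\varphi$ and $\sigma$, $\varphi\simeq\omega\to\varphi$, $\omega\simeq\omega\to\omega$, $\sigma\simeq\sigma\wedge\omega$, $\sigma\simeq\omega\wedge\sigma$, $\omega\simeq\sigma\vee\omega$ and $\omega\simeq\omega\vee\sigma$. The *normalisation pre-order* $\le$ is the least pre-order on types such that $\sigma\le\omega$; $\sigma\wedge\tau\le\sigma$; $\sigma\wedge\tau\le\tau$; $\sigma\le\sigma\vee\tau$; $\tau\le\sigma\vee\tau$; $\sigma\le\tau$ and $\sigma\le\rho$ imply $\sigma\le\tau\wedge\rho$; $\sigma\le\tau$ and $\rho\le\tau$ imply $\sigma\vee\rho\le\tau$; $\varphi\le\sigma\to\varphi$; $\omega\le\sigma\to\omega$; $\sigma'\le\sigma$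 and $\tau\le\tau'$ imply $\sigma\to\tau\le\sigma'\to\tau'$. The *inner rules* are: - $\omega\to\varphi\rightsquigarrow\varphi$; - $\sigma\rightsquigarrow\omega$ if $\omega\le\sigma$ and $\sigma\neq\omega$; - $\sigma\to\tau\wedge\rho\rightsquigarrow(\sigma\to\tau)\wedge(\sigma\to\rho)$; - $\sigma\vee\tau\to\rho\rightsquigarrow(\sigma\to\rho)\wedge(\tau\to\rho)$; - $(\sigma\vee\tau)\wedge\rho\to\zeta\rightsquigarrow(\sigma\wedge\rho)\vee(\tau\wedge\rho)\to\zeta$; - $\sigma\to(\tau\wedge\rho)\vee\zeta\rightsquigarrow\sigma\to(\tau\vee\zeta)\wedge(\rho\vee\zeta)$; - $\sigma\wedge\tau\rightsquigarrow\sigma$ and $\sigma\vee\tau\rightsquigarrow\tau$ if $\sigma\le\tau$. The *top rules* are: $C[\sigma]\Longrightarrow C[\tau]$ for every type context $C$ whenever $\sigma\rightsquigarrow\tau$; and $C[(\sigma\wedge\tau)\vee\rho]\Longrightarrow C[(\sigma\vee\rho)\wedge(\tau\vee\rho)]$ for every type context $C$ whose hole is at top level, i.e. not inside an arrow. Types are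 rewritten by $\Longrightarrow$ modulo commutativity and associativity of $\wedge$ and $\vee$: a class of types modulo commutativity and associativity rewrites in one step to another class if some representative of the first rewrites by a top rule to some representative of the second. A normal form of $\sigma$ is a class, reached from the class of $\sigma$ by finitely many (possibly zero) steps, that does not rewrite to any class. Then every type $\sigma$ has exactly one normal form, denoted $\mathrm{nf}(\sigma)$, and for all types $\sigma,\tau$: if $\sigma\simeq\tau$, then $\mathrm{nf}(\sigma)=\mathrm{nf}(\tau)$. The converse fails: there are types $\sigma,\tau$ with $\mathrm{nf}(\sigma)=\mathrm{nf}(\tau)$ but $\sigma\not\simeq\tau$. -/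

import Mathlib

namespace IUTypes

/-- Types over a set `A` of atoms: atoms, the constant `ω`, arrows, intersections, unions. -/
inductive Ty (A : Type*) where
  | atom : A → Ty A
  | omega : Ty A
  | arrow : Ty A → Ty A → Ty A
  | inter : Ty A → Ty A → Ty A
  | union : Ty A → Ty A → Ty A

variable {A : Type*}

/-- Semantic equivalence: the least congruence satisfying the six listed equivalences. -/
inductive SemEq : Ty A → Ty A → Prop
  | refl (σ) : SemEq σ σ
  | symm {σ τ} : SemEq σ τ → SemEq τ σ
  | trans {σ τ ρ} : SemEq σ τ → SemEq τ ρ → SemEq σ ρ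
  | arrow {σ σ' τ τ'} : SemEq σ σ' → SemEq τ τ' → SemEq (.arrow σ τ) (.arrow σ' τ')
  | inter {σ σ' τ τ'} : SemEq σ σ' → SemEq τ τ' → SemEq (.inter σ τ) (.inter σ' τ')
  | union {σ σ' τ τ'} : SemEq σ σ' → SemEq τ τ' → SemEq (.union σ τ) (.union σ' τ')
  | atom_eq (a : A) : SemEq (.atom a) (.arrow .omega (.atom a))
  | omega_eq : SemEq .omega (.arrow .omega .omega)
  | inter_omega (σ) : SemEq σ (.inter σ .omega)
  | omega_inter (σ) : SemEq σ (.inter .omega σ)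
  | union_omega (σ) : SemEq .omega (.union σ .omega)
  | omega_union (σ) : SemEq .omega (.union .omega σ)

/-- The normalisation pre-order on types. -/
inductive Le : Ty A → Ty A → Prop
  | refl (σ) : Le σ σ
  | trans {σ τ ρ} : Le σ τ → Le τ ρ → Le σ ρ
  | le_omega (σ) : Le σ .omega
  | inter_left (σ τ) : Le (.inter σ τ) σ
  | inter_right (σ τ) : Le (.inter σ τ) τ
  | union_left (σ τ) : Le σ (.union σ τ)
  | union_right (σ τ) : Le τ (.union σ τ)
  | le_inter {σ τ ρ} : Le σ τ → Le σ ρ → Le σ (.inter τ ρ)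
  | union_le {σ τ ρ} : Le σ τ → Le ρ τ → Le (.union σ ρ) τ
  | atom_le (a : A) (σ) : Le (.atom a) (.arrow σ (.atom a))
  | omega_le (σ) : Le .omega (.arrow σ .omega)
  | arrow {σ σ' τ τ'} : Le σ' σ → Le τ τ' → Le (.arrow σ τ) (.arrow σ' τ')

/-- Type contexts (with exactly one hole). -/
inductive Ctx (A : Type*) where
  | hole : Ctx A
  | arrowL : Ctx A → Ty A → Ctx A
  | arrowR : Ty A → Ctx A → Ctx A
  | interL : Ctx A → Ty A → Ctx A
  | interR : Ty A → Ctx A → Ctx A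
  | unionL : Ctx A → Ty A → Ctx A
  | unionR : Ty A → Ctx A → Ctx A

/-- Filling the hole of a context with a type. -/
def Ctx.fill : Ctx A → Ty A → Ty A
  | .hole, σ => σ
  | .arrowL C ρ, σ => .arrow (C.fill σ) ρ
  | .arrowR ρ C, σ => .arrow ρ (C.fill σ)
  | .interL C ρ, σ => .inter (C.fill σ) ρ
  | .interR ρ C, σ => .inter ρ (C.fill σ)
  | .unionL C ρ, σ => .union (C.fill σ) ρ
  | .unionR ρ C, σ => .union ρ (C.fill σ)

/-- The hole is at top level, that is, not inside an arrow. -/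
def Ctx.TopLevel : Ctx A → Prop
  | .hole => True
  | .arrowL _ _ => False
  | .arrowR _ _ => False
  | .interL C _ => C.TopLevel
  | .interR _ C => C.TopLevel
  | .unionL C _ => C.TopLevel
  | .unionR _ C => C.TopLevel

/-- The inner normalisation rules. -/
inductive Inner : Ty A → Ty A → Prop
  | atom (a : A) : Inner (.arrow .omega (.atom a)) (.atom a)
  | omega {σ : Ty A} : Le .omega σ → σ ≠ .omega → Inner σ .omega
  | arrow_inter (σ τ ρ) :
      Inner (.arrow σ (.inter τ ρ)) (.inter (.arrow σ τ) (.arrow σ ρ))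
  | arrow_distL (σ τ ρ ζ) :
      Inner (.arrow (.inter (.union σ τ) ρ) ζ) (.arrow (.union (.inter σ ρ) (.inter τ ρ)) ζ)
  | union_arrow (σ τ ρ) :
      Inner (.arrow (.union σ τ) ρ) (.inter (.arrow σ ρ) (.arrow τ ρ))
  | arrow_distR (σ τ ρ ζ) :
      Inner (.arrow σ (.union (.inter τ ρ) ζ)) (.arrow σ (.inter (.union τ ζ) (.union ρ ζ)))
  | erase_inter {σ τ} : Le σ τ → Inner (.inter σ τ) σ
  | erase_union {σ τ} : Le σ τ → Inner (.union σ τ) τ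

/-- The top normalisation rules: inner rules in arbitrary contexts, and distribution of union
over intersection at top level. -/
inductive Top : Ty A → Ty A → Prop
  | ctx (C : Ctx A) {σ τ : Ty A} : Inner σ τ → Top (C.fill σ) (C.fill τ)
  | dist (C : Ctx A) (σ τ ρ : Ty A) : C.TopLevel →
      Top (C.fill (.union (.inter σ τ) ρ)) (C.fill (.inter (.union σ ρ) (.union τ ρ)))

/-- Equality modulo commutativity and associativity of intersection and of union. -/
inductive AC : Ty A → Ty A → Prop
  | refl (σ) : AC σ σ
  | symm {σ τ} : AC σ τ → AC τ σ
  | trans {σ τ ρ} : AC σ τ → AC τ ρ → AC σ ρ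
  | arrow {σ σ' τ τ'} : AC σ σ' → AC τ τ' → AC (.arrow σ τ) (.arrow σ' τ')
  | inter {σ σ' τ τ'} : AC σ σ' → AC τ τ' → AC (.inter σ τ) (.inter σ' τ')
  | union {σ σ' τ τ'} : AC σ σ' → AC τ τ' → AC (.union σ τ) (.union σ' τ')
  | inter_comm (σ τ) : AC (.inter σ τ) (.inter τ σ)
  | union_comm (σ τ) : AC (.union σ τ) (.union τ σ)
  | inter_assoc (σ τ ρ) : AC (.inter (.inter σ τ) ρ) (.inter σ (.inter τ ρ))
  | union_assoc (σ τ ρ) : AC (.union (.union σ τ) ρ) (.union σ (.union τ ρ))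

/-- `AC` as a setoid on types. -/
def acSetoid (A : Type*) : Setoid (Ty A) :=
  ⟨AC, AC.refl, AC.symm, AC.trans⟩

/-- Types modulo commutativity and associativity. -/
def TyAC (A : Type*) : Type _ := Quotient (acSetoid A)

/-- The class of a type modulo commutativity and associativity. -/
def Ty.cls (σ : Ty A) : TyAC A := Quotient.mk (acSetoid A) σ

/-- One top normalisation step, on types modulo commutativity and associativity. -/
def Step (p q : TyAC A) : Prop := ∃ σ τ : Ty A, σ.cls = p ∧ τ.cls = q ∧ Top σ τ

/-- `q` is a normal form of `σ`: it is reached from `σ` by finitely many steps, and no step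
applies to it. -/
def IsNF (σ : Ty A) (q : TyAC A) : Prop :=
  Relation.ReflTransGen Step σ.cls q ∧ ∀ r, ¬ Step q r

/-- The normal form of a type, a type modulo commutativity and associativity. -/
noncomputable def nf (σ : Ty A) : TyAC A :=
  @Classical.epsilon (TyAC A) ⟨σ.cls⟩ (IsNF σ)

end IUTypes

/-!
Types decompose, up to distributivity, into `Factor`s: atoms, and arrows from a conjunction of
factors to a disjunction of factors. Factors carry an explicit preorder `Factor.Below`, which is
transitive by a direct induction on size (this plays the part of cut elimination). A type is
interpreted as a predicate on the up-sets of factors (`Holds`), with `∧` and `∨` read as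
conjunction and disjunction; the arrow is read through the disjunctive normal form of its domain
and the conjunctive normal form of its codomain. The normalisation pre-order entails inclusion of
predicates (`Le.entails`), and all rewriting rules, `AC` and `SemEq` preserve the predicate
(`Top.equivalent`, `AC.equivalent`, `SemEq.equivalent`).

Existence of normal forms is strong normalisation. Distributivity is oriented in one way in
domains of arrows and in the other way elsewhere, so each type gets two weights, one for either
position; inner rules decrease both, and distribution at top level decreases the first
(`Top.cnfWeight_lt`).

For uniqueness no confluence argument is needed: it suffices that equivalent irreducible types are
equal modulo `AC` (`Irreducible.cls_eq`). An irreducible type is an irredundant conjunction of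
irredundant disjunctions of hereditarily irredundant factors (`Irreducible.exists_clauses`).
Evaluating at suitable up-sets turns entailment between two such types into mutual domination of
their lists of clauses (`exists_clauseBelow`). On these factors `Factor.Below` implies the
normalisation pre-order (`Factor.Below.le`), so that irredundant lists dominating each other match
one to one (`perm_map_of_mutual`), hereditarily.

The same fact shows that semantically equivalent types share their normal form. The converse fails
because `φ ∧ φ` normalises to `φ`, whereas semantic equivalence preserves a count of atoms
(`atomCount`) that distinguishes them.
-/

namespace IUTypes

variable {A : Type*}

/-! ### Prime factors and their preorder -/

/-- The factors into which types decompose up to distributivity: atoms, and arrows from a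
conjunction of factors (the first list) to a disjunction of factors (the second list). The empty
first list stands for `ω`. -/
inductive Factor (A : Type*) where
  | atom : A → Factor A
  | arr : List (Factor A) → List (Factor A) → Factor A

/-- The preorder on factors. An arrow is below an atom only if its domain is `ω`, which reflects
the equivalence of `ω → φ` and `φ`. In `arr` the functions `f` and `g` choose the witnesses of
the comparison of the domains (as conjunctions) and of the codomains (as disjunctions). -/
inductive Factor.Below : Factor A → Factor A → Prop
  | atom (a : A) : Below (.atom a) (.atom a)
  | atom_arr {a : A} {S T : List (Factor A)} {t : Factor A} :
      t ∈ T → Below (.atom a) t → Below (.atom a) (.arr S T)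
  | arr_atom {a : A} {T : List (Factor A)} :
      (∀ t ∈ T, Below t (.atom a)) → Below (.arr [] T) (.atom a)
  | arr {S S' T T' : List (Factor A)} (f g : Factor A → Factor A) :
      (∀ s ∈ S, f s ∈ S') → (∀ s ∈ S, Below (f s) s) →
      (∀ t ∈ T, g t ∈ T') → (∀ t ∈ T, Below t (g t)) → Below (.arr S T) (.arr S' T')

namespace Factor

theorem Below.arr_of_exists {S S' T T' : List (Factor A)}
    (hS : ∀ s ∈ S, ∃ s' ∈ S', Below s' s) (hT : ∀ t ∈ T, ∃ t' ∈ T', Below t t') :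
    Below (.arr S T) (.arr S' T') := by
  choose! f hf hf' using hS
  choose! g hg hg' using hT
  exact .arr f g hf hf' hg hg'

theorem Below.refl : ∀ p : Factor A, Below p p
  | .atom a => .atom a
  | .arr S T => .arr_of_exists (fun s _ => ⟨s, ‹_›, Below.refl s⟩) (fun t _ => ⟨t, ‹_›, Below.refl t⟩)

theorem Below.trans {p q r : Factor A} (hpq : Below p q) (hqr : Below q r) : Below p r := by
  cases hpq with
  | atom a => exact hqr
  | @atom_arr a S T t ht h =>
    cases hqr with
    | arr_atom h' => exact h.trans (h' t ht)
    | arr f g hf hf' hg hg' => exact .atom_arr (hg t ht) (h.trans (hg' t ht))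
  | @arr_atom a T h =>
    cases hqr with
    | atom => exact .arr_atom h
    | @atom_arr _ S' T' t' ht' h' =>
      exact .arr_of_exists (by simp) fun t ht => ⟨t', ht', (h t ht).trans h'⟩
  | @arr S S' T T' f g hf hf' hg hg' =>
    cases hqr with
    | @arr_atom b _ h' =>
      obtain rfl : S = [] := List.eq_nil_iff_forall_not_mem.2 fun s hs => by simpa using hf s hs
      exact .arr_atom fun t ht => (hg' t ht).trans (h' _ (hg t ht))
    | arr f₂ g₂ hf₂ hf₂' hg₂ hg₂' =>
      exact .arr_of_exists
        (fun s hs => ⟨_, hf₂ _ (hf s hs), (hf₂' _ (hf s hs)).trans (hf' s hs)⟩)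
        (fun t ht => ⟨_, hg₂ _ (hg t ht), (hg' t ht).trans (hg₂' _ (hg t ht))⟩)
termination_by sizeOf p + sizeOf q + sizeOf r
decreasing_by
  all_goals subst_vars
  all_goals simp only [Factor.atom.sizeOf_spec, Factor.arr.sizeOf_spec]
  · have := List.sizeOf_lt_of_mem ht; omega
  · have := List.sizeOf_lt_of_mem ht; have := List.sizeOf_lt_of_mem (hg t ht); omega
  · have := List.sizeOf_lt_of_mem ht; have := List.sizeOf_lt_of_mem ht'; omega
  · have := List.sizeOf_lt_of_mem ht; have := List.sizeOf_lt_of_mem (hg t ht); omega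
  · have := List.sizeOf_lt_of_mem hs; have := List.sizeOf_lt_of_mem (hf s hs)
    have := List.sizeOf_lt_of_mem (hf₂ _ (hf s hs)); omega
  · have := List.sizeOf_lt_of_mem ht; have := List.sizeOf_lt_of_mem (hg t ht)
    have := List.sizeOf_lt_of_mem (hg₂ _ (hg t ht)); omega

end Factor

open Factor

/-! ### Interpretation of types by up-sets of factors -/

mutual
/-- A conjunctive normal form: a conjunction of disjunctions of factors. -/
def Ty.cnf : Ty A → List (List (Factor A))
  | .atom a => [[.atom a]]
  | .omega => []
  | .arrow σ τ => σ.dnf.flatMap fun S => τ.cnf.map fun T => [.arr S T]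
  | .inter σ τ => σ.cnf ++ τ.cnf
  | .union σ τ => σ.cnf.flatMap fun C => τ.cnf.map fun D => C ++ D
/-- A disjunctive normal form: a disjunction of conjunctions of factors. -/
def Ty.dnf : Ty A → List (List (Factor A))
  | .atom a => [[.atom a]]
  | .omega => [[]]
  | .arrow σ τ => [σ.dnf.flatMap fun S => τ.cnf.map fun T => .arr S T]
  | .inter σ τ => σ.dnf.flatMap fun C => τ.dnf.map fun D => C ++ D
  | .union σ τ => σ.dnf ++ τ.dnf
end

/-- A type holds at a set of factors if its conjunctive normal form does, where a factor counts
as true when it belongs to the set. -/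
def Holds (U : Set (Factor A)) (σ : Ty A) : Prop := ∀ C ∈ σ.cnf, ∃ c ∈ C, c ∈ U

section Holds

variable {U : Set (Factor A)} {σ τ : Ty A}

theorem holds_atom {a : A} : Holds U (.atom a) ↔ Factor.atom a ∈ U := by simp [Holds, Ty.cnf]

theorem holds_omega : Holds U .omega := by simp [Holds, Ty.cnf]

theorem holds_arrow :
    Holds U (.arrow σ τ) ↔ ∀ S ∈ σ.dnf, ∀ T ∈ τ.cnf, Factor.arr S T ∈ U := by
  simp only [Holds, Ty.cnf, List.mem_flatMap, List.mem_map]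
  constructor
  · intro h S hS T hT
    simpa using h _ ⟨S, hS, T, hT, rfl⟩
  · rintro h _ ⟨S, hS, T, hT, rfl⟩
    simpa using h S hS T hT

theorem holds_inter : Holds U (.inter σ τ) ↔ Holds U σ ∧ Holds U τ := by
  simp only [Holds, Ty.cnf, List.mem_append, or_imp, forall_and]

theorem holds_union : Holds U (.union σ τ) ↔ Holds U σ ∨ Holds U τ := by
  simp only [Holds, Ty.cnf, List.mem_flatMap, List.mem_map]
  constructor
  · intro h
    by_contra! hn
    obtain ⟨⟨C, hC, hC'⟩, D, hD, hD'⟩ := hn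
    obtain ⟨c, hc, hcU⟩ := h _ ⟨C, hC, D, hD, rfl⟩
    rcases List.mem_append.1 hc with hc | hc
    exacts [hC' c hc hcU, hD' c hc hcU]
  · rintro (h | h) _ ⟨C, hC, D, hD, rfl⟩
    · obtain ⟨c, hc, hcU⟩ := h C hC
      exact ⟨c, by simp [hc], hcU⟩
    · obtain ⟨c, hc, hcU⟩ := h D hD
      exact ⟨c, by simp [hc], hcU⟩

theorem holds_iff_dnf (σ : Ty A) : Holds U σ ↔ ∃ S ∈ σ.dnf, ∀ s ∈ S, s ∈ U := by
  induction σ with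
  | atom a => simp [holds_atom, Ty.dnf]
  | omega => simp [holds_omega, Ty.dnf]
  | arrow σ τ =>
    simp only [holds_arrow, Ty.dnf, List.mem_singleton, exists_eq_left, List.mem_flatMap,
      List.mem_map]
    exact ⟨by rintro h _ ⟨S, hS, T, hT, rfl⟩; exact h S hS T hT,
      fun h S hS T hT => h _ ⟨S, hS, T, hT, rfl⟩⟩
  | inter σ τ ihσ ihτ =>
    rw [holds_inter, ihσ, ihτ]
    simp only [Ty.dnf, List.mem_flatMap, List.mem_map]
    constructor
    · rintro ⟨⟨S, hS, hSU⟩, T, hT, hTU⟩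
      refine ⟨_, ⟨S, hS, T, hT, rfl⟩, fun s hs => ?_⟩
      rcases List.mem_append.1 hs with hs | hs
      exacts [hSU s hs, hTU s hs]
    · rintro ⟨_, ⟨S, hS, T, hT, rfl⟩, h⟩
      exact ⟨⟨S, hS, fun s hs => h s (by simp [hs])⟩, T, hT, fun s hs => h s (by simp [hs])⟩
  | union σ τ ihσ ihτ =>
    rw [holds_union, ihσ, ihτ]
    simp only [Ty.dnf, List.mem_append, or_and_right, exists_or]

end Holds

/-- `U` is closed upwards for the preorder on factors. -/
def IsUp (U : Set (Factor A)) : Prop := ∀ p q, Below p q → p ∈ U → q ∈ U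

/-- Semantic entailment between types, over all up-sets of factors. -/
def Entails (σ τ : Ty A) : Prop := ∀ U, IsUp U → Holds U σ → Holds U τ

/-- Entailment is contravariant in the domain and covariant in the codomain of arrows: the
witnesses come from testing it on the up-set generated by a conjunct of the domain, and on the
complement of the down-set generated by a clause of the codomain. -/
theorem Entails.arrow {σ σ' τ τ' : Ty A} (hσ : Entails σ' σ) (hτ : Entails τ τ') :
    Entails (.arrow σ τ) (.arrow σ' τ') := by
  intro U hU h
  rw [holds_arrow] at h ⊢
  intro S' hS' T' hT'
  obtain ⟨S, hS, hSS'⟩ := (holds_iff_dnf σ).1 <|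
    hσ {p | ∃ s ∈ S', Below s p} (fun p q hpq ⟨s, hs, hsp⟩ => ⟨s, hs, hsp.trans hpq⟩)
      ((holds_iff_dnf σ').2 ⟨S', hS', fun s hs => ⟨s, hs, .refl s⟩⟩)
  have hT : ¬ Holds {p | ¬ ∃ t ∈ T', Below p t} τ := fun hτh => by
    obtain ⟨t, ht, htU⟩ := hτ {p | ¬ ∃ t ∈ T', Below p t}
      (fun p q hpq hp ⟨t, ht, hqt⟩ => hp ⟨t, ht, hpq.trans hqt⟩) hτh T' hT'
    exact htU ⟨t, ht, .refl t⟩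
  simp only [Holds, not_forall, not_exists, Set.mem_ofPred_eq, not_and, not_not] at hT
  obtain ⟨T, hT, hTT'⟩ := hT
  refine hU _ _ (.arr_of_exists hSS' fun t ht => ?_) (h S hS T hT)
  simpa using hTT' t ht

theorem Le.entails {σ τ : Ty A} (h : Le σ τ) : Entails σ τ := by
  induction h with
  | refl => exact fun _ _ h => h
  | trans _ _ h₁ h₂ => exact fun U hU h => h₂ U hU (h₁ U hU h)
  | le_omega => exact fun _ _ _ => holds_omega
  | inter_left => exact fun _ _ h => (holds_inter.1 h).1
  | inter_right => exact fun _ _ h => (holds_inter.1 h).2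
  | union_left => exact fun _ _ h => holds_union.2 (.inl h)
  | union_right => exact fun _ _ h => holds_union.2 (.inr h)
  | le_inter _ _ h₁ h₂ => exact fun U hU h => holds_inter.2 ⟨h₁ U hU h, h₂ U hU h⟩
  | union_le _ _ h₁ h₂ => exact fun U hU h => (holds_union.1 h).elim (h₁ U hU) (h₂ U hU)
  | atom_le a σ =>
    intro U hU h
    rw [holds_atom] at h
    simp only [holds_arrow, Ty.cnf, List.mem_singleton, forall_eq]
    exact fun S _ => hU _ _ (.atom_arr (List.mem_singleton_self _) (.atom a)) h
  | omega_le => exact fun _ _ _ => by simp [holds_arrow, Ty.cnf]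
  | arrow _ _ h₁ h₂ => exact h₁.arrow h₂

theorem entails_arrow_omega_atom (a : A) : Entails (.arrow .omega (.atom a)) (.atom a) := by
  intro U hU h
  simp only [holds_arrow, Ty.cnf, Ty.dnf, List.mem_singleton, forall_eq] at h
  exact holds_atom.2 (hU _ _ (.arr_atom (by simpa using .atom a)) h)

/-- Mutual entailment. -/
def Equivalent (σ τ : Ty A) : Prop := ∀ U, IsUp U → (Holds U σ ↔ Holds U τ)

theorem Equivalent.of_entails {σ τ : Ty A} (h₁ : Entails σ τ) (h₂ : Entails τ σ) :
    Equivalent σ τ := fun U hU => ⟨h₁ U hU, h₂ U hU⟩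

namespace Equivalent

variable {σ σ' τ τ' ρ : Ty A}

theorem refl (σ : Ty A) : Equivalent σ σ := fun _ _ => Iff.rfl

theorem symm (h : Equivalent σ τ) : Equivalent τ σ := fun U hU => (h U hU).symm

theorem trans (h₁ : Equivalent σ τ) (h₂ : Equivalent τ ρ) : Equivalent σ ρ :=
  fun U hU => (h₁ U hU).trans (h₂ U hU)

theorem le (h : Equivalent σ τ) : Entails σ τ := fun U hU => (h U hU).1

theorem ge (h : Equivalent σ τ) : Entails τ σ := fun U hU => (h U hU).2

theorem arrow (h₁ : Equivalent σ σ') (h₂ : Equivalent τ τ') :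
    Equivalent (.arrow σ τ) (.arrow σ' τ') :=
  .of_entails (h₁.ge.arrow h₂.le) (h₁.le.arrow h₂.ge)

theorem inter (h₁ : Equivalent σ σ') (h₂ : Equivalent τ τ') :
    Equivalent (.inter σ τ) (.inter σ' τ') := fun U hU => by
  rw [holds_inter, holds_inter, h₁ U hU, h₂ U hU]

theorem union (h₁ : Equivalent σ σ') (h₂ : Equivalent τ τ') :
    Equivalent (.union σ τ) (.union σ' τ') := fun U hU => by
  rw [holds_union, holds_union, h₁ U hU, h₂ U hU]

theorem fill (h : Equivalent σ τ) (C : Ctx A) : Equivalent (C.fill σ) (C.fill τ) := by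
  induction C with
  | hole => exact h
  | arrowL C ρ ih => exact ih.arrow (refl ρ)
  | arrowR ρ C ih => exact (refl ρ).arrow ih
  | interL C ρ ih => exact ih.inter (refl ρ)
  | interR ρ C ih => exact (refl ρ).inter ih
  | unionL C ρ ih => exact ih.union (refl ρ)
  | unionR ρ C ih => exact (refl ρ).union ih

theorem inter_union (σ τ ρ : Ty A) :
    Equivalent (.inter (.union σ τ) ρ) (.union (.inter σ ρ) (.inter τ ρ)) := fun U _ => by
  simp only [holds_union, holds_inter, or_and_right]

theorem union_inter (σ τ ρ : Ty A) :
    Equivalent (.union (.inter σ τ) ρ) (.inter (.union σ ρ) (.union τ ρ)) := fun U _ => by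
  simp only [holds_union, holds_inter, and_or_right]

theorem arrow_omega_atom (a : A) : Equivalent (.arrow .omega (.atom a)) (.atom a) :=
  .of_entails (entails_arrow_omega_atom a) (Le.atom_le a _).entails

end Equivalent

theorem Inner.equivalent {σ τ : Ty A} (h : Inner σ τ) : Equivalent σ τ := by
  cases h with
  | atom a => exact .arrow_omega_atom a
  | omega h => exact .of_entails (Le.le_omega _).entails h.entails
  | arrow_inter σ τ ρ =>
    intro U _
    simp only [holds_inter, holds_arrow, Ty.cnf, List.mem_append, or_imp, forall_and]
  | arrow_distL σ τ ρ ζ => exact (Equivalent.inter_union σ τ ρ).arrow (.refl ζ)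
  | union_arrow σ τ ρ =>
    intro U _
    simp only [holds_inter, holds_arrow, Ty.dnf, List.mem_append, or_imp, forall_and]
  | arrow_distR σ τ ρ ζ => exact (Equivalent.refl σ).arrow (.union_inter τ ρ ζ)
  | erase_inter h =>
    exact .of_entails (Le.inter_left _ _).entails (Le.le_inter (.refl _) h).entails
  | erase_union h =>
    exact .of_entails (Le.union_le h (.refl _)).entails (Le.union_right _ _).entails

theorem Top.equivalent {σ τ : Ty A} (h : Top σ τ) : Equivalent σ τ := by
  cases h with
  | ctx C h => exact h.equivalent.fill C
  | dist C σ τ ρ _ => exact (Equivalent.union_inter σ τ ρ).fill C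

theorem AC.equivalent {σ τ : Ty A} (h : AC σ τ) : Equivalent σ τ := by
  induction h with
  | refl σ => exact .refl σ
  | symm _ ih => exact ih.symm
  | trans _ _ h₁ h₂ => exact h₁.trans h₂
  | arrow _ _ h₁ h₂ => exact h₁.arrow h₂
  | inter _ _ h₁ h₂ => exact h₁.inter h₂
  | union _ _ h₁ h₂ => exact h₁.union h₂
  | inter_comm => exact fun U _ => by simp only [holds_inter, and_comm]
  | union_comm => exact fun U _ => by simp only [holds_union, or_comm]
  | inter_assoc => exact fun U _ => by simp only [holds_inter, and_assoc]
  | union_assoc => exact fun U _ => by simp only [holds_union, or_assoc]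

theorem SemEq.equivalent {σ τ : Ty A} (h : SemEq σ τ) : Equivalent σ τ := by
  induction h with
  | refl σ => exact .refl σ
  | symm _ ih => exact ih.symm
  | trans _ _ h₁ h₂ => exact h₁.trans h₂
  | arrow _ _ h₁ h₂ => exact h₁.arrow h₂
  | inter _ _ h₁ h₂ => exact h₁.inter h₂
  | union _ _ h₁ h₂ => exact h₁.union h₂
  | atom_eq a => exact (Equivalent.arrow_omega_atom a).symm
  | omega_eq => exact fun U _ => by simp [holds_omega, holds_arrow, Ty.cnf]
  | inter_omega => exact fun U _ => by simp [holds_inter, holds_omega]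
  | omega_inter => exact fun U _ => by simp [holds_inter, holds_omega]
  | union_omega => exact fun U _ => by simp [holds_union, holds_omega]
  | omega_union => exact fun U _ => by simp [holds_union, holds_omega]

/-! ### Strong normalisation -/

mutual
/-- The weight of a type in a position where unions are distributed over intersections. -/
def Ty.cnfWeight : Ty A → ℕ
  | .atom _ => 2
  | .omega => 2
  | .arrow σ τ => σ.dnfWeight * τ.cnfWeight
  | .inter σ τ => σ.cnfWeight + τ.cnfWeight + 1
  | .union σ τ => σ.cnfWeight * τ.cnfWeight
/-- The weight of a type in a position where intersections are distributed over unions. -/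
def Ty.dnfWeight : Ty A → ℕ
  | .atom _ => 2
  | .omega => 2
  | .arrow σ τ => 2 ^ (σ.dnfWeight * τ.cnfWeight)
  | .inter σ τ => σ.dnfWeight * τ.dnfWeight
  | .union σ τ => σ.dnfWeight + τ.dnfWeight + 1
end

theorem two_le_weight (σ : Ty A) : 2 ≤ σ.cnfWeight ∧ 2 ≤ σ.dnfWeight := by
  induction σ with
  | atom | omega => simp [Ty.cnfWeight, Ty.dnfWeight]
  | arrow σ τ h₁ h₂ =>
    have h : 2 ≤ σ.dnfWeight * τ.cnfWeight := by nlinarith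
    exact ⟨h, h.trans Nat.lt_two_pow_self.le⟩
  | inter σ τ h₁ h₂ | union σ τ h₁ h₂ =>
    simp only [Ty.cnfWeight, Ty.dnfWeight]
    constructor <;> nlinarith

theorem AC.weight_eq {σ τ : Ty A} (h : AC σ τ) :
    σ.cnfWeight = τ.cnfWeight ∧ σ.dnfWeight = τ.dnfWeight := by
  induction h with
  | refl => exact ⟨rfl, rfl⟩
  | symm _ ih => exact ⟨ih.1.symm, ih.2.symm⟩
  | trans _ _ h₁ h₂ => exact ⟨h₁.1.trans h₂.1, h₁.2.trans h₂.2⟩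
  | arrow _ _ h₁ h₂ | inter _ _ h₁ h₂ | union _ _ h₁ h₂ =>
    simp [Ty.cnfWeight, Ty.dnfWeight, h₁, h₂]
  | inter_comm | union_comm | inter_assoc | union_assoc =>
    constructor <;> simp only [Ty.cnfWeight, Ty.dnfWeight] <;> ring

theorem Inner.weight_lt {σ τ : Ty A} (h : Inner σ τ) :
    τ.cnfWeight < σ.cnfWeight ∧ τ.dnfWeight < σ.dnfWeight := by
  have hpow {m n : ℕ} (h : m < n) : 2 ^ m < 2 ^ n := Nat.pow_lt_pow_right (by norm_num) h
  cases h with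
  | atom a => simp [Ty.cnfWeight, Ty.dnfWeight]
  | @omega σ h hne =>
    cases σ with
    | atom a =>
      -- At the empty up-set `ω` holds and an atom does not.
      have := h.entails ∅ (fun _ _ _ h => h) holds_omega
      simp [holds_atom] at this
    | omega => exact absurd rfl hne
    | arrow σ τ =>
      have h₁ := (two_le_weight σ).2
      have h₂ := (two_le_weight τ).1
      have h : 2 < σ.dnfWeight * τ.cnfWeight := by nlinarith
      exact ⟨h, h.trans Nat.lt_two_pow_self⟩
    | inter σ τ | union σ τ =>
      have h₁ := two_le_weight σ
      have h₂ := two_le_weight τ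
      simp only [Ty.cnfWeight, Ty.dnfWeight]
      constructor <;> nlinarith
  | arrow_inter σ τ ρ =>
    have := two_le_weight σ
    simp only [Ty.cnfWeight, Ty.dnfWeight, ← pow_add]
    exact ⟨by nlinarith, hpow (by nlinarith)⟩
  | union_arrow σ τ ρ =>
    have := two_le_weight ρ
    simp only [Ty.cnfWeight, Ty.dnfWeight, ← pow_add]
    exact ⟨by nlinarith, hpow (by nlinarith)⟩
  | arrow_distL σ τ ρ ζ =>
    have h₁ := (two_le_weight ρ).2
    have h₂ := (two_le_weight ζ).1
    have h : (σ.dnfWeight * ρ.dnfWeight + τ.dnfWeight * ρ.dnfWeight + 1) * ζ.cnfWeight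
        < (σ.dnfWeight + τ.dnfWeight + 1) * ρ.dnfWeight * ζ.cnfWeight :=
      Nat.mul_lt_mul_of_pos_right (by nlinarith) (by omega)
    exact ⟨h, hpow h⟩
  | arrow_distR σ τ ρ ζ =>
    have h₁ := (two_le_weight ζ).1
    have h₂ := (two_le_weight σ).2
    have h : σ.dnfWeight * (τ.cnfWeight * ζ.cnfWeight + ρ.cnfWeight * ζ.cnfWeight + 1)
        < σ.dnfWeight * ((τ.cnfWeight + ρ.cnfWeight + 1) * ζ.cnfWeight) :=
      Nat.mul_lt_mul_of_pos_left (by nlinarith) (by omega)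
    exact ⟨h, hpow h⟩
  | @erase_inter _ ρ _ | @erase_union ρ _ _ =>
    have h₁ := two_le_weight ρ
    have h₂ := two_le_weight τ
    simp only [Ty.cnfWeight, Ty.dnfWeight]
    constructor <;> nlinarith

theorem fill_weight_lt {σ τ : Ty A}
    (h : τ.cnfWeight < σ.cnfWeight ∧ τ.dnfWeight < σ.dnfWeight) (C : Ctx A) :
    (C.fill τ).cnfWeight < (C.fill σ).cnfWeight ∧
      (C.fill τ).dnfWeight < (C.fill σ).dnfWeight := by
  have hpow {m n : ℕ} (h : m < n) : 2 ^ m < 2 ^ n := Nat.pow_lt_pow_right (by norm_num) h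
  induction C with
  | hole => exact h
  | arrowL C ρ ih =>
    have h' := Nat.mul_lt_mul_of_pos_right ih.2 (by linarith [(two_le_weight ρ).1] : 0 < ρ.cnfWeight)
    exact ⟨h', hpow h'⟩
  | arrowR ρ C ih =>
    have h' := Nat.mul_lt_mul_of_pos_left ih.1 (by linarith [(two_le_weight ρ).2] : 0 < ρ.dnfWeight)
    exact ⟨h', hpow h'⟩
  | interL C ρ ih | interR ρ C ih | unionL C ρ ih | unionR ρ C ih =>
    obtain ⟨h₁, h₂⟩ := two_le_weight ρ
    obtain ⟨h₃, h₄⟩ := ih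
    simp only [Ctx.fill, Ty.cnfWeight, Ty.dnfWeight]
    constructor <;> nlinarith

theorem fill_cnfWeight_lt {σ τ : Ty A} (h : τ.cnfWeight < σ.cnfWeight) (C : Ctx A)
    (hC : C.TopLevel) : (C.fill τ).cnfWeight < (C.fill σ).cnfWeight := by
  induction C with
  | hole => exact h
  | arrowL | arrowR => exact hC.elim
  | interL C ρ ih | interR ρ C ih | unionL C ρ ih | unionR ρ C ih =>
    obtain ⟨h₁, -⟩ := two_le_weight ρ
    have := ih hC
    simp only [Ctx.fill, Ty.cnfWeight]
    nlinarith

theorem Top.cnfWeight_lt {σ τ : Ty A} (h : Top σ τ) : τ.cnfWeight < σ.cnfWeight := by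
  cases h with
  | ctx C h => exact (fill_weight_lt h.weight_lt C).1
  | dist C σ τ ρ hC =>
    have := two_le_weight ρ
    refine fill_cnfWeight_lt ?_ C hC
    simp only [Ty.cnfWeight]
    nlinarith

theorem cls_eq {σ τ : Ty A} : σ.cls = τ.cls ↔ AC σ τ :=
  ⟨fun h => Quotient.exact h, fun h => Quotient.sound (s := acSetoid A) h⟩

theorem exists_isNF (σ : Ty A) : ∃ q, IsNF σ q := by
  induction h : σ.cnfWeight using Nat.strong_induction_on generalizing σ with
  | _ n ih =>
    by_cases hs : ∃ r, Step σ.cls r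
    · obtain ⟨_, σ', τ, hσ', rfl, hst⟩ := hs
      have hlt := hst.cnfWeight_lt
      rw [(cls_eq.1 hσ').weight_eq.1, h] at hlt
      obtain ⟨q, hq, hirr⟩ := ih _ hlt τ rfl
      exact ⟨q, .head ⟨σ', τ, hσ', rfl, hst⟩ hq, hirr⟩
    · exact ⟨σ.cls, .refl, fun r hr => hs ⟨r, hr⟩⟩

theorem IsNF.exists_equivalent {σ : Ty A} {q : TyAC A} (h : IsNF σ q) :
    ∃ τ : Ty A, τ.cls = q ∧ Equivalent σ τ := by
  obtain ⟨h, -⟩ := h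
  induction h with
  | refl => exact ⟨σ, rfl, .refl σ⟩
  | tail _ hs ih =>
    obtain ⟨τ, rfl, hτ⟩ := ih
    obtain ⟨τ', ρ, h', rfl, hst⟩ := hs
    exact ⟨ρ, rfl, hτ.trans ((cls_eq.1 h').symm.equivalent.trans hst.equivalent)⟩

/-! ### Conjunctions and disjunctions of lists -/

/-- The right-nested combination of a list by a binary operation. The value `d` at the empty list
is not used in longer lists, so that `d` need not be a unit of `op`. -/
def fold {α : Type*} (op : α → α → α) (d : α) : List α → α
  | [] => d
  | [x] => x
  | x :: y :: l => op x (fold op d (y :: l))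

section fold

variable {α β : Type*} {op : α → α → α} {d : α}

theorem fold_cons (x : α) {l : List α} (h : l ≠ []) : fold op d (x :: l) = op x (fold op d l) := by
  cases l with
  | nil => exact absurd rfl h
  | cons y l => rfl

theorem map_fold (f : α → β) {op' : β → β → β} (hf : ∀ x y, f (op x y) = op' (f x) (f y))
    (l : List α) : f (fold op d l) = fold op' (f d) (l.map f) := by
  induction l with
  | nil => rfl
  | cons x l ih =>
    by_cases h : l = []
    · subst h; rfl
    · rw [fold_cons x h, hf, ih, List.map_cons, fold_cons _ (by simpa using h)]

theorem fold_append (ha : ∀ x y z, op (op x y) z = op x (op y z)) {l l' : List α} (h : l ≠ [])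
    (h' : l' ≠ []) : fold op d (l ++ l') = op (fold op d l) (fold op d l') := by
  induction l with
  | nil => exact absurd rfl h
  | cons x l ih =>
    by_cases hl : l = []
    · subst hl; exact fold_cons x h'
    · rw [List.cons_append, fold_cons x (by simp [hl]), fold_cons x hl, ih hl, ha]

theorem fold_perm (ha : ∀ x y z, op (op x y) z = op x (op y z)) (hc : ∀ x y, op x y = op y x)
    {l l' : List α} (h : l.Perm l') : fold op d l = fold op d l' := by
  induction h with
  | nil => rfl
  | @cons x l l' h ih =>
    by_cases hl : l = []
    · subst hl; rw [List.nil_perm.1 h]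
    · rw [fold_cons x hl, fold_cons x fun h' => hl (List.perm_nil.1 (h' ▸ h)), ih]
  | swap x y l =>
    by_cases hl : l = []
    · subst hl; exact hc y x
    · rw [fold_cons y (by simp), fold_cons x hl, fold_cons x (by simp), fold_cons y hl, ← ha, hc y,
        ha]
  | trans _ _ h₁ h₂ => exact h₁.trans h₂

end fold

/-- The intersection of two classes. -/
def TyAC.inter : TyAC A → TyAC A → TyAC A :=
  Quotient.map₂ Ty.inter fun _ _ h _ _ h' => AC.inter h h'

/-- The union of two classes. -/
def TyAC.union : TyAC A → TyAC A → TyAC A :=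
  Quotient.map₂ Ty.union fun _ _ h _ _ h' => AC.union h h'

namespace TyAC

theorem inter_assoc (p q r : TyAC A) : inter (inter p q) r = inter p (inter q r) :=
  Quotient.inductionOn₃ p q r fun _ _ _ => cls_eq.2 (.inter_assoc _ _ _)

theorem inter_comm (p q : TyAC A) : inter p q = inter q p :=
  Quotient.inductionOn₂ p q fun _ _ => cls_eq.2 (.inter_comm _ _)

theorem union_assoc (p q r : TyAC A) : union (union p q) r = union p (union q r) :=
  Quotient.inductionOn₃ p q r fun _ _ _ => cls_eq.2 (.union_assoc _ _ _)

theorem union_comm (p q : TyAC A) : union p q = union q p :=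
  Quotient.inductionOn₂ p q fun _ _ => cls_eq.2 (.union_comm _ _)

end TyAC

/-- The intersection of a list of types; `ω` for the empty list. -/
def interList : List (Ty A) → Ty A := fold .inter .omega

/-- The union of a list of types; the value at the empty list is irrelevant. -/
def unionList : List (Ty A) → Ty A := fold .union .omega

theorem cls_interList (l : List (Ty A)) :
    (interList l).cls = fold TyAC.inter Ty.omega.cls (l.map Ty.cls) :=
  map_fold Ty.cls (fun _ _ => rfl) l

theorem cls_unionList (l : List (Ty A)) :
    (unionList l).cls = fold TyAC.union Ty.omega.cls (l.map Ty.cls) :=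
  map_fold Ty.cls (fun _ _ => rfl) l

theorem interList_perm {l l' : List (Ty A)} (h : (l.map Ty.cls).Perm (l'.map Ty.cls)) :
    AC (interList l) (interList l') := by
  rw [← cls_eq, cls_interList, cls_interList, fold_perm TyAC.inter_assoc TyAC.inter_comm h]

theorem unionList_perm {l l' : List (Ty A)} (h : (l.map Ty.cls).Perm (l'.map Ty.cls)) :
    AC (unionList l) (unionList l') := by
  rw [← cls_eq, cls_unionList, cls_unionList, fold_perm TyAC.union_assoc TyAC.union_comm h]

theorem interList_append {l l' : List (Ty A)} (h : l ≠ []) (h' : l' ≠ []) :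
    AC (interList (l ++ l')) (.inter (interList l) (interList l')) := by
  rw [← cls_eq]
  change _ = TyAC.inter (interList l).cls (interList l').cls
  rw [cls_interList, cls_interList, cls_interList, List.map_append,
    fold_append TyAC.inter_assoc (by simpa using h) (by simpa using h')]

theorem unionList_append {l l' : List (Ty A)} (h : l ≠ []) (h' : l' ≠ []) :
    AC (unionList (l ++ l')) (.union (unionList l) (unionList l')) := by
  rw [← cls_eq]
  change _ = TyAC.union (unionList l).cls (unionList l').cls
  rw [cls_unionList, cls_unionList, cls_unionList, List.map_append,
    fold_append TyAC.union_assoc (by simpa using h) (by simpa using h')]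

theorem le_interList {σ : Ty A} {l : List (Ty A)} (h : ∀ τ ∈ l, Le σ τ) : Le σ (interList l) := by
  induction l with
  | nil => exact .le_omega σ
  | cons τ l ih =>
    by_cases hl : l = []
    · subst hl; exact h τ (by simp)
    · rw [interList, fold_cons τ hl]
      exact .le_inter (h τ (by simp)) (ih fun ρ hρ => h ρ (by simp [hρ]))

theorem interList_le {σ : Ty A} {l : List (Ty A)} (h : σ ∈ l) : Le (interList l) σ := by
  induction l with
  | nil => simp at h
  | cons τ l ih =>
    by_cases hl : l = []
    · subst hl; obtain rfl := List.mem_singleton.1 h; exact .refl _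
    · rw [interList, fold_cons τ hl]
      rcases List.mem_cons.1 h with rfl | h
      exacts [.inter_left _ _, (Le.inter_right _ _).trans (ih h)]

theorem unionList_le {σ : Ty A} {l : List (Ty A)} (hne : l ≠ []) (h : ∀ τ ∈ l, Le τ σ) :
    Le (unionList l) σ := by
  induction l with
  | nil => exact absurd rfl hne
  | cons τ l ih =>
    by_cases hl : l = []
    · subst hl; exact h τ (by simp)
    · rw [unionList, fold_cons τ hl]
      exact .union_le (h τ (by simp)) (ih hl fun ρ hρ => h ρ (by simp [hρ]))

theorem le_unionList {σ : Ty A} {l : List (Ty A)} (h : σ ∈ l) : Le σ (unionList l) := by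
  induction l with
  | nil => simp at h
  | cons τ l ih =>
    by_cases hl : l = []
    · subst hl; obtain rfl := List.mem_singleton.1 h; exact .refl _
    · rw [unionList, fold_cons τ hl]
      rcases List.mem_cons.1 h with rfl | h
      exacts [.union_left _ _, (ih h).trans (.union_right _ _)]

theorem AC.le_and_ge {σ τ : Ty A} (h : AC σ τ) : Le σ τ ∧ Le τ σ := by
  induction h with
  | refl σ => exact ⟨.refl σ, .refl σ⟩
  | symm _ ih => exact ih.symm
  | trans _ _ h₁ h₂ => exact ⟨h₁.1.trans h₂.1, h₂.2.trans h₁.2⟩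
  | arrow _ _ h₁ h₂ => exact ⟨.arrow h₁.2 h₂.1, .arrow h₁.1 h₂.2⟩
  | inter _ _ h₁ h₂ =>
    exact ⟨.le_inter ((Le.inter_left _ _).trans h₁.1) ((Le.inter_right _ _).trans h₂.1),
      .le_inter ((Le.inter_left _ _).trans h₁.2) ((Le.inter_right _ _).trans h₂.2)⟩
  | union _ _ h₁ h₂ =>
    exact ⟨.union_le (h₁.1.trans (.union_left _ _)) (h₂.1.trans (.union_right _ _)),
      .union_le (h₁.2.trans (.union_left _ _)) (h₂.2.trans (.union_right _ _))⟩
  | inter_comm σ τ =>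
    exact ⟨.le_inter (.inter_right _ _) (.inter_left _ _),
      .le_inter (.inter_right _ _) (.inter_left _ _)⟩
  | union_comm σ τ =>
    exact ⟨.union_le (.union_right _ _) (.union_left _ _),
      .union_le (.union_right _ _) (.union_left _ _)⟩
  | inter_assoc σ τ ρ =>
    exact ⟨.le_inter ((Le.inter_left _ _).trans (.inter_left _ _))
        (.le_inter ((Le.inter_left _ _).trans (.inter_right _ _)) (.inter_right _ _)),
      .le_inter (.le_inter (.inter_left _ _) ((Le.inter_right _ _).trans (.inter_left _ _)))
        ((Le.inter_right _ _).trans (.inter_right _ _))⟩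
  | union_assoc σ τ ρ =>
    exact ⟨.union_le (.union_le (.union_left _ _) ((Le.union_left _ _).trans (.union_right _ _)))
        ((Le.union_right _ _).trans (.union_right _ _)),
      .union_le ((Le.union_left _ _).trans (.union_left _ _))
        (.union_le ((Le.union_right _ _).trans (.union_left _ _)) (.union_right _ _))⟩

/-! ### Irredundant lists -/

/-- The types in a list are pairwise incomparable for the normalisation pre-order. -/
def Irredundant (l : List (Ty A)) : Prop := l.Pairwise fun σ τ => ¬ Le σ τ ∧ ¬ Le τ σ

theorem Irredundant.nodup_cls {l : List (Ty A)} (h : Irredundant l) : (l.map Ty.cls).Nodup :=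
  List.pairwise_map.2 <| List.Pairwise.imp (fun h h' => h.1 (cls_eq.1 h').le_and_ge.1) h

theorem Irredundant.eq_of_le {α : Type*} {f : α → Ty A} {l : List α} (h : Irredundant (l.map f))
    {x y : α} (hx : x ∈ l) (hy : y ∈ l) (hle : Le (f x) (f y)) : x = y := by
  by_contra hne
  have : Std.Symm fun x y => ¬ Le (f x) (f y) ∧ ¬ Le (f y) (f x) := ⟨fun _ _ h => h.symm⟩
  exact ((List.pairwise_map.1 h).forall hx hy hne).1 hle

theorem irredundant_of_perm {l : List (Ty A)}
    (h : ∀ σ τ rest, l.Perm (σ :: τ :: rest) → ¬ Le σ τ) : Irredundant l := by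
  refine List.pairwise_iff_forall_sublist.2 fun {σ τ} hst => ?_
  obtain ⟨rest, hrest⟩ := hst.exists_perm_append
  exact ⟨h σ τ rest hrest, h τ σ rest (hrest.trans (.swap _ _ _))⟩

/-- Two lists that dominate each other for a transitive relation, neither of which has two
distinct related elements, agree up to order under a map that identifies mutually related
elements. -/
theorem perm_map_of_mutual {α β : Type*} {r : α → α → Prop} (ht : ∀ x y z, r x y → r y z → r x z)
    {f : α → β} {l l' : List α} (h₁ : ∀ x ∈ l, ∃ y ∈ l', r y x) (h₂ : ∀ y ∈ l', ∃ x ∈ l, r x y)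
    (a₁ : ∀ x ∈ l, ∀ y ∈ l, r x y → x = y) (a₂ : ∀ x ∈ l', ∀ y ∈ l', r x y → x = y)
    (n₁ : (l.map f).Nodup) (n₂ : (l'.map f).Nodup)
    (hf : ∀ x ∈ l, ∀ y ∈ l', r x y → r y x → f x = f y) : (l.map f).Perm (l'.map f) := by
  refine (List.perm_ext_iff_of_nodup n₁ n₂).2 fun b => ?_
  simp only [List.mem_map]
  constructor
  · rintro ⟨x, hx, rfl⟩
    obtain ⟨y, hy, hyx⟩ := h₁ x hx
    obtain ⟨z, hz, hzy⟩ := h₂ y hy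
    obtain rfl := a₁ z hz x hx (ht _ _ _ hzy hyx)
    exact ⟨y, hy, (hf _ hx y hy hzy hyx).symm⟩
  · rintro ⟨y, hy, rfl⟩
    obtain ⟨x, hx, hxy⟩ := h₂ y hy
    obtain ⟨z, hz, hzx⟩ := h₁ x hx
    obtain rfl := a₂ z hz y hy (ht _ _ _ hzx hxy)
    exact ⟨x, hx, hf x hx _ hy hxy hzx⟩

/-! ### Normal factors -/

namespace Factor

/-- The type denoted by a factor. -/
def toTy : Factor A → Ty A
  | .atom a => .atom a
  | .arr S T => .arrow (interList (S.map toTy)) (unionList (T.map toTy))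

/-- The factors that denote irreducible types. -/
inductive Normal : Factor A → Prop
  | atom (a : A) : Normal (.atom a)
  | arr {S T : List (Factor A)} : (∀ s ∈ S, Normal s) → (∀ t ∈ T, Normal t) → T ≠ [] →
      Irredundant (S.map toTy) → Irredundant (T.map toTy) → (∀ a, S = [] → T ≠ [.atom a]) →
      Normal (.arr S T)

theorem Normal.eq_of_below_atom {p : Factor A} {a : A} (hp : Normal p) (h : Below p (.atom a)) :
    p = .atom a := by
  induction hp with
  | atom b => cases h; rfl
  | @arr S T _ _ hne _ hT hST _ ih =>
    exfalso
    cases h with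
    | arr_atom h =>
      -- All members of `T` are equal to the atom, so irredundancy makes `T` a singleton.
      have hall : ∀ t ∈ T, t = .atom a := fun t ht => ih t ht (h t ht)
      match T, hne, hT, hST, hall with
      | [t], _, _, hST, hall => exact hST a rfl (by rw [hall t (by simp)])
      | t :: t' :: T, _, hT, _, hall =>
        have := (List.pairwise_cons.1 hT).1 t'.toTy (by simp)
        rw [hall t (by simp), hall t' (by simp)] at this
        exact this.1 (.refl _)

theorem interList_map_le {S S' : List (Factor A)}
    (h : ∀ s ∈ S, ∃ s' ∈ S', Le s'.toTy s.toTy) :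
    Le (interList (S'.map toTy)) (interList (S.map toTy)) := by
  refine le_interList fun τ hτ => ?_
  obtain ⟨s, hs, rfl⟩ := List.mem_map.1 hτ
  obtain ⟨s', hs', hle⟩ := h s hs
  exact (interList_le (List.mem_map_of_mem hs')).trans hle

theorem unionList_map_le {T T' : List (Factor A)} (hne : T ≠ [])
    (h : ∀ t ∈ T, ∃ t' ∈ T', Le t.toTy t'.toTy) :
    Le (unionList (T.map toTy)) (unionList (T'.map toTy)) := by
  refine unionList_le (by simpa using hne) fun τ hτ => ?_
  obtain ⟨t, ht, rfl⟩ := List.mem_map.1 hτ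
  obtain ⟨t', ht', hle⟩ := h t ht
  exact hle.trans (le_unionList (List.mem_map_of_mem ht'))

/-- On normal factors the only comparison that the normalisation pre-order lacks, that of
`ω → φ` with `φ`, does not occur. -/
theorem Below.le {p q : Factor A} (h : Below p q) (hp : Normal p) (hq : Normal q) :
    Le p.toTy q.toTy := by
  induction h with
  | atom a => exact .refl _
  | @atom_arr a S T t ht _ ih =>
    cases hq with
    | arr _ hT _ _ _ _ =>
      rw [toTy, toTy]
      refine (Le.atom_le a (interList (S.map toTy))).trans (.arrow (.refl _) ?_)
      have := ih hp (hT t ht)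
      rw [toTy] at this
      exact this.trans (le_unionList (List.mem_map_of_mem ht))
  | arr_atom h => cases hp.eq_of_below_atom (.arr_atom h)
  | arr f g hf _ hg _ ihf ihg =>
    cases hp with
    | arr hS hT hne _ _ _ =>
      cases hq with
      | arr hS' hT' _ _ _ _ =>
        rw [toTy, toTy]
        exact .arrow
          (interList_map_le fun s hs => ⟨f s, hf s hs, ihf s hs (hS' _ (hf s hs)) (hS s hs)⟩) <|
          unionList_map_le hne fun t ht => ⟨g t, hg t ht, ihg t ht (hT t ht) (hT' _ (hg t ht))⟩

theorem eq_of_below {l : List (Factor A)} (hn : ∀ p ∈ l, Normal p) (h : Irredundant (l.map toTy)) :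
    ∀ p ∈ l, ∀ q ∈ l, Below p q → p = q :=
  fun _ hp _ hq hpq => h.eq_of_le hp hq (hpq.le (hn _ hp) (hn _ hq))

/-- The preorder on normal factors is antisymmetric modulo commutativity and associativity. -/
theorem Normal.cls_eq {p q : Factor A} (hp : Normal p) (hq : Normal q) (hpq : Below p q)
    (hqp : Below q p) : p.toTy.cls = q.toTy.cls := by
  induction hp generalizing q with
  | atom a => rw [hq.eq_of_below_atom hqp]
  | @arr S T hS hT hne aS aT hST ihS ihT =>
    cases hq with
    | atom a => cases (Normal.arr hS hT hne aS aT hST).eq_of_below_atom hpq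
    | @arr S' T' hS' hT' hne' aS' aT' hST' =>
      cases hpq with
      | arr f g hf hf' hg hg' =>
        cases hqp with
        | arr f₂ g₂ hf₂ hf₂' hg₂ hg₂' =>
          rw [toTy, toTy, IUTypes.cls_eq]
          refine .arrow (interList_perm ?_) (unionList_perm ?_)
          · rw [List.map_map, List.map_map]
            exact perm_map_of_mutual (r := Below) (fun _ _ _ => Below.trans)
              (fun s hs => ⟨_, hf s hs, hf' s hs⟩) (fun s hs => ⟨_, hf₂ s hs, hf₂' s hs⟩)
              (eq_of_below hS aS) (eq_of_below hS' aS')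
              (by simpa using aS.nodup_cls) (by simpa using aS'.nodup_cls)
              fun s hs s' hs' h h' => ihS s hs (hS' s' hs') h h'
          · rw [List.map_map, List.map_map]
            exact perm_map_of_mutual (r := fun x y => Below y x) (fun _ _ _ h h' => h'.trans h)
              (fun t ht => ⟨_, hg t ht, hg' t ht⟩) (fun t ht => ⟨_, hg₂ t ht, hg₂' t ht⟩)
              (fun x hx y hy h => (eq_of_below hT aT y hy x hx h).symm)
              (fun x hx y hy h => (eq_of_below hT' aT' y hy x hx h).symm)
              (by simpa using aT.nodup_cls) (by simpa using aT'.nodup_cls)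
              fun t ht t' ht' h h' => ihT t ht (hT' t' ht') h' h

end Factor

/-! ### Normal conjunctions of clauses -/

/-- The type denoted by a clause, a disjunction of factors. -/
def clauseTy (T : List (Factor A)) : Ty A := unionList (T.map toTy)

/-- Comparison of clauses. -/
def ClauseBelow (C D : List (Factor A)) : Prop := ∀ c ∈ C, ∃ d ∈ D, Below c d

/-- A nonempty irredundant disjunction of normal factors. -/
structure NormalClause (C : List (Factor A)) : Prop where
  normal : ∀ c ∈ C, Normal c
  ne_nil : C ≠ []
  irredundant : Irredundant (C.map toTy)

/-- An irredundant conjunction of normal clauses. -/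
structure NormalCnf (X : List (List (Factor A))) : Prop where
  normal : ∀ C ∈ X, NormalClause C
  irredundant : Irredundant (X.map clauseTy)

theorem ClauseBelow.trans {C D E : List (Factor A)} (h₁ : ClauseBelow C D) (h₂ : ClauseBelow D E) :
    ClauseBelow C E := fun c hc => by
  obtain ⟨d, hd, hcd⟩ := h₁ c hc
  obtain ⟨e, he, hde⟩ := h₂ d hd
  exact ⟨e, he, hcd.trans hde⟩

theorem ClauseBelow.le {C D : List (Factor A)} (h : ClauseBelow C D) (hC : NormalClause C)
    (hD : NormalClause D) : Le (clauseTy C) (clauseTy D) :=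
  unionList_map_le hC.ne_nil fun c hc =>
    let ⟨d, hd, hcd⟩ := h c hc
    ⟨d, hd, hcd.le (hC.normal c hc) (hD.normal d hd)⟩

theorem NormalClause.cls_eq {C D : List (Factor A)} (hC : NormalClause C) (hD : NormalClause D)
    (hCD : ClauseBelow C D) (hDC : ClauseBelow D C) : (clauseTy C).cls = (clauseTy D).cls := by
  refine IUTypes.cls_eq.2 (unionList_perm ?_)
  rw [List.map_map, List.map_map]
  exact perm_map_of_mutual (r := fun x y => Below y x) (fun _ _ _ h h' => h'.trans h) hCD hDC
    (fun x hx y hy h => (eq_of_below hC.normal hC.irredundant y hy x hx h).symm)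
    (fun x hx y hy h => (eq_of_below hD.normal hD.irredundant y hy x hx h).symm)
    (by simpa using hC.irredundant.nodup_cls) (by simpa using hD.irredundant.nodup_cls)
    fun c hc d hd h h' => (hC.normal c hc).cls_eq (hD.normal d hd) h' h

theorem cnf_unionList {l : List (Factor A)} (hl : l ≠ []) (h : ∀ p ∈ l, p.toTy.cnf = [[p]]) :
    (clauseTy l).cnf = [l] := by
  induction l with
  | nil => exact absurd rfl hl
  | cons p l ih =>
    by_cases hl : l = []
    · subst hl; exact h p (by simp)
    · have := ih hl fun q hq => h q (by simp [hq])
      rw [clauseTy, unionList, List.map_cons, fold_cons _ (by simpa using hl), Ty.cnf,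
        h p (by simp)]
      change List.flatMap (fun C => (clauseTy l).cnf.map fun D => C ++ D) [[p]] = _
      simp [this]

theorem dnf_interList {l : List (Factor A)} (h : ∀ p ∈ l, p.toTy.dnf = [[p]]) :
    (interList (l.map toTy)).dnf = [l] := by
  induction l with
  | nil => simp [interList, fold, Ty.dnf]
  | cons p l ih =>
    by_cases hl : l = []
    · subst hl; exact h p (by simp)
    · have := ih fun q hq => h q (by simp [hq])
      rw [interList, List.map_cons, fold_cons _ (by simpa using hl), Ty.dnf, h p (by simp)]
      change List.flatMap (fun C => (interList (l.map toTy)).dnf.map fun D => C ++ D) [[p]] = _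
      simp [this]

theorem Factor.Normal.cnf_dnf {p : Factor A} (h : Normal p) :
    p.toTy.cnf = [[p]] ∧ p.toTy.dnf = [[p]] := by
  induction h with
  | atom a => simp [toTy, Ty.cnf, Ty.dnf]
  | arr _ _ hne _ _ _ ihS ihT =>
    have h₁ := dnf_interList fun s hs => (ihS s hs).2
    have h₂ := cnf_unionList hne fun t ht => (ihT t ht).1
    rw [clauseTy] at h₂
    simp [toTy, Ty.cnf, Ty.dnf, h₁, h₂]

theorem holds_interList {U : Set (Factor A)} {l : List (Ty A)} :
    Holds U (interList l) ↔ ∀ σ ∈ l, Holds U σ := by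
  induction l with
  | nil => simp [interList, fold, holds_omega]
  | cons σ l ih =>
    by_cases hl : l = []
    · subst hl; simp [interList, fold]
    · rw [interList, fold_cons σ hl, holds_inter, ← interList, ih]
      simp

theorem holds_interList_clauseTy {U : Set (Factor A)} {X : List (List (Factor A))}
    (hX : NormalCnf X) : Holds U (interList (X.map clauseTy)) ↔ ∀ C ∈ X, ∃ c ∈ C, c ∈ U := by
  simp only [holds_interList, List.forall_mem_map]
  refine forall₂_congr fun C hC => ?_
  have h := hX.normal C hC
  rw [Holds, cnf_unionList h.ne_nil fun c hc => (h.normal c hc).cnf_dnf.1]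
  simp

/-- Entailment of conjunctions of clauses is clausewise: test it on the complement of the
down-set generated by the clause `D`. -/
theorem exists_clauseBelow {X Y : List (List (Factor A))} (hX : NormalCnf X) (hY : NormalCnf Y)
    (h : Entails (interList (X.map clauseTy)) (interList (Y.map clauseTy))) :
    ∀ D ∈ Y, ∃ C ∈ X, ClauseBelow C D := by
  intro D hD
  by_contra! hn
  obtain ⟨d, hd, hdU⟩ := (holds_interList_clauseTy hY).1
    (h {p | ¬ ∃ d ∈ D, Below p d} (fun p q hpq hp ⟨d, hd, hqd⟩ => hp ⟨d, hd, hpq.trans hqd⟩)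
      ((holds_interList_clauseTy hX).2 fun C hC => by
        simpa [ClauseBelow] using hn C hC)) D hD
  exact hdU ⟨d, hd, .refl d⟩

theorem NormalCnf.cls_eq {X Y : List (List (Factor A))} (hX : NormalCnf X) (hY : NormalCnf Y)
    (h : Equivalent (interList (X.map clauseTy)) (interList (Y.map clauseTy))) :
    (interList (X.map clauseTy)).cls = (interList (Y.map clauseTy)).cls := by
  have aux {X : List (List (Factor A))} (hX : NormalCnf X) :
      ∀ C ∈ X, ∀ D ∈ X, ClauseBelow C D → C = D := fun C hC D hD hCD =>
    hX.irredundant.eq_of_le hC hD (hCD.le (hX.normal C hC) (hX.normal D hD))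
  refine IUTypes.cls_eq.2 (interList_perm ?_)
  rw [List.map_map, List.map_map]
  exact perm_map_of_mutual (r := ClauseBelow) (fun _ _ _ => ClauseBelow.trans)
    (exists_clauseBelow hY hX h.ge) (exists_clauseBelow hX hY h.le) (aux hX) (aux hY)
    (by simpa using hX.irredundant.nodup_cls) (by simpa using hY.irredundant.nodup_cls)
    fun C hC D hD => (hX.normal C hC).cls_eq (hY.normal D hD)

/-! ### The shape of irreducible types -/

/-- No type equal to `σ` modulo commutativity and associativity contains an inner redex. -/
def InnerIrreducible (σ : Ty A) : Prop :=
  ∀ (C : Ctx A) (s t : Ty A), AC σ (C.fill s) → ¬ Inner s t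

/-- No union occurs outside the arrows. -/
def Ty.UnionFree : Ty A → Prop
  | .inter σ τ => σ.UnionFree ∧ τ.UnionFree
  | .union _ _ => False
  | _ => True

/-- No intersection occurs outside the arrows. -/
def Ty.InterFree : Ty A → Prop
  | .inter _ _ => False
  | .union σ τ => σ.InterFree ∧ τ.InterFree
  | _ => True

theorem exists_union_of_not_unionFree {σ : Ty A} (h : ¬ σ.UnionFree) :
    ∃ a b, AC σ (.union a b) ∨ ∃ c, AC σ (.inter (.union a b) c) := by
  induction σ with
  | atom | omega | arrow => exact absurd trivial h
  | union σ τ => exact ⟨σ, τ, .inl (.refl _)⟩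
  | inter σ τ ihσ ihτ =>
    rw [Ty.UnionFree, not_and_or] at h
    rcases h with h | h
    · obtain ⟨a, b, h | ⟨c, h⟩⟩ := ihσ h
      · exact ⟨a, b, .inr ⟨τ, .inter h (.refl τ)⟩⟩
      · exact ⟨a, b, .inr ⟨.inter c τ, (AC.inter h (.refl τ)).trans (.inter_assoc _ _ _)⟩⟩
    · obtain ⟨a, b, h | ⟨c, h⟩⟩ := ihτ h
      · exact ⟨a, b, .inr ⟨σ, (AC.inter_comm _ _).trans (.inter h (.refl σ))⟩⟩
      · exact ⟨a, b, .inr ⟨.inter c σ, (AC.inter_comm _ _).trans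
          ((AC.inter h (.refl σ)).trans (.inter_assoc _ _ _))⟩⟩

theorem exists_inter_of_not_interFree {σ : Ty A} (h : ¬ σ.InterFree) :
    ∃ a b, AC σ (.inter a b) ∨ ∃ c, AC σ (.union (.inter a b) c) := by
  induction σ with
  | atom | omega | arrow => exact absurd trivial h
  | inter σ τ => exact ⟨σ, τ, .inl (.refl _)⟩
  | union σ τ ihσ ihτ =>
    rw [Ty.InterFree, not_and_or] at h
    rcases h with h | h
    · obtain ⟨a, b, h | ⟨c, h⟩⟩ := ihσ h
      · exact ⟨a, b, .inr ⟨τ, .union h (.refl τ)⟩⟩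
      · exact ⟨a, b, .inr ⟨.union c τ, (AC.union h (.refl τ)).trans (.union_assoc _ _ _)⟩⟩
    · obtain ⟨a, b, h | ⟨c, h⟩⟩ := ihτ h
      · exact ⟨a, b, .inr ⟨σ, (AC.union_comm _ _).trans (.union h (.refl σ))⟩⟩
      · exact ⟨a, b, .inr ⟨.union c σ, (AC.union_comm _ _).trans
          ((AC.union h (.refl σ)).trans (.union_assoc _ _ _))⟩⟩

namespace InnerIrreducible

variable {σ τ : Ty A}

theorem arrow_left (h : InnerIrreducible (.arrow σ τ)) : InnerIrreducible σ :=
  fun C s t hs => h (.arrowL C τ) s t (.arrow hs (.refl τ))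

theorem arrow_right (h : InnerIrreducible (.arrow σ τ)) : InnerIrreducible τ :=
  fun C s t hs => h (.arrowR σ C) s t (.arrow (.refl σ) hs)

theorem inter_left (h : InnerIrreducible (.inter σ τ)) : InnerIrreducible σ :=
  fun C s t hs => h (.interL C τ) s t (.inter hs (.refl τ))

theorem inter_right (h : InnerIrreducible (.inter σ τ)) : InnerIrreducible τ :=
  fun C s t hs => h (.interR σ C) s t (.inter (.refl σ) hs)

theorem union_left (h : InnerIrreducible (.union σ τ)) : InnerIrreducible σ :=
  fun C s t hs => h (.unionL C τ) s t (.union hs (.refl τ))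

theorem union_right (h : InnerIrreducible (.union σ τ)) : InnerIrreducible τ :=
  fun C s t hs => h (.unionR σ C) s t (.union (.refl σ) hs)

theorem unionFree_domain (h : InnerIrreducible (.arrow σ τ)) : σ.UnionFree := by
  by_contra hn
  obtain ⟨a, b, hσ | ⟨c, hσ⟩⟩ := exists_union_of_not_unionFree hn
  · exact h .hole _ _ (.arrow hσ (.refl τ)) (.union_arrow _ _ _)
  · exact h .hole _ _ (.arrow hσ (.refl τ)) (.arrow_distL _ _ _ _)

theorem interFree_codomain (h : InnerIrreducible (.arrow σ τ)) : τ.InterFree := by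
  by_contra hn
  obtain ⟨a, b, hτ | ⟨c, hτ⟩⟩ := exists_inter_of_not_interFree hn
  · exact h .hole _ _ (.arrow (.refl σ) hτ) (.arrow_inter _ _ _)
  · exact h .hole _ _ (.arrow (.refl σ) hτ) (.arrow_distR _ _ _ _)

theorem codomain_not_omega (h : InnerIrreducible (.arrow σ τ)) : ¬ AC τ .omega := fun hτ =>
  h .hole _ _ (.arrow (.refl σ) hτ) (.omega (.omega_le σ) (by simp))

theorem not_omega_of_inter (h : InnerIrreducible (.inter σ τ)) :
    ¬ AC σ .omega ∧ ¬ AC τ .omega :=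
  ⟨fun h' => h .hole _ _ ((AC.inter_comm _ _).trans (.inter (.refl τ) h'))
    (.erase_inter (.le_omega τ)),
  fun h' => h .hole _ _ (.inter (.refl σ) h') (.erase_inter (.le_omega σ))⟩

theorem not_omega_of_union (h : InnerIrreducible (.union σ τ)) :
    ¬ AC σ .omega ∧ ¬ AC τ .omega :=
  ⟨fun h' => h .hole _ _ ((AC.union_comm _ _).trans (.union (.refl τ) h'))
    (.erase_union (.le_omega τ)),
  fun h' => h .hole _ _ (.union (.refl σ) h') (.erase_union (.le_omega σ))⟩

theorem irredundant_inter {l : List (Ty A)} (h : InnerIrreducible σ) (hl : AC σ (interList l)) :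
    Irredundant l := by
  refine irredundant_of_perm fun a b rest hp hab => ?_
  have hl := hl.trans (interList_perm (hp.map _))
  cases rest with
  | nil => exact h .hole _ _ hl (.erase_inter hab)
  | cons c rest =>
    exact h (.interL .hole (interList (c :: rest))) _ _
      (hl.trans (AC.inter_assoc _ _ _).symm) (.erase_inter hab)

theorem irredundant_union {l : List (Ty A)} (h : InnerIrreducible σ) (hl : AC σ (unionList l)) :
    Irredundant l := by
  refine irredundant_of_perm fun a b rest hp hab => ?_
  have hl := hl.trans (unionList_perm (hp.map _))
  cases rest with
  | nil => exact h .hole _ _ hl (.erase_union hab)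
  | cons c rest =>
    exact h (.unionL .hole (unionList (c :: rest))) _ _
      (hl.trans (AC.union_assoc _ _ _).symm) (.erase_union hab)

/-- Irreducible conjunctions, as in the domain of an arrow, and irreducible disjunctions, as in
its codomain, consist of normal factors. -/
theorem exists_factors (h : InnerIrreducible σ) :
    (σ.UnionFree → ∃ S : List (Factor A), (∀ s ∈ S, Normal s) ∧ AC σ (interList (S.map toTy))) ∧
    (σ.InterFree → ¬ AC σ .omega →
      ∃ T : List (Factor A), (∀ t ∈ T, Normal t) ∧ T ≠ [] ∧ AC σ (unionList (T.map toTy))) := by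
  induction σ with
  | atom a =>
    have : toTy (.atom a) = .atom a := by rw [toTy]
    exact ⟨fun _ => ⟨[.atom a], by simpa using .atom a, by simp [interList, fold, this, AC.refl]⟩,
      fun _ _ => ⟨[.atom a], by simpa using .atom a, by simp,
        by simp [unionList, fold, this, AC.refl]⟩⟩
  | omega => exact ⟨fun _ => ⟨[], by simp, .refl _⟩, fun _ h => absurd (.refl _) h⟩
  | arrow σ τ ihσ ihτ =>
    obtain ⟨S, hS, hσS⟩ := (ihσ h.arrow_left).1 h.unionFree_domain
    obtain ⟨T, hT, hne, hτT⟩ := (ihτ h.arrow_right).2 h.interFree_codomain h.codomain_not_omega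
    have hp : Normal (.arr S T) := by
      refine .arr hS hT hne (h.arrow_left.irredundant_inter hσS)
        (h.arrow_right.irredundant_union hτT) ?_
      rintro a rfl rfl
      rw [List.map_singleton, toTy] at hτT
      exact h .hole _ _ (.arrow hσS hτT) (.atom a)
    have hac : AC (.arrow σ τ) (toTy (.arr S T)) := by
      rw [toTy]
      exact .arrow hσS hτT
    exact ⟨fun _ => ⟨[.arr S T], by simpa using hp, hac⟩,
      fun _ _ => ⟨[.arr S T], by simpa using hp, by simp, hac⟩⟩
  | inter σ τ ihσ ihτ =>
    refine ⟨fun hf => ?_, fun hf => hf.elim⟩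
    obtain ⟨S, hS, hσ⟩ := (ihσ h.inter_left).1 hf.1
    obtain ⟨S', hS', hτ⟩ := (ihτ h.inter_right).1 hf.2
    have hne : S ≠ [] := by rintro rfl; exact h.not_omega_of_inter.1 hσ
    have hne' : S' ≠ [] := by rintro rfl; exact h.not_omega_of_inter.2 hτ
    refine ⟨S ++ S', fun s hs => (List.mem_append.1 hs).elim (hS s) (hS' s), ?_⟩
    rw [List.map_append]
    exact (AC.inter hσ hτ).trans (interList_append (by simpa using hne) (by simpa using hne')).symm
  | union σ τ ihσ ihτ =>
    refine ⟨fun hf => hf.elim, fun hf _ => ?_⟩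
    obtain ⟨T, hT, hne, hσ⟩ := (ihσ h.union_left).2 hf.1 h.not_omega_of_union.1
    obtain ⟨T', hT', hne', hτ⟩ := (ihτ h.union_right).2 hf.2 h.not_omega_of_union.2
    refine ⟨T ++ T', fun s hs => (List.mem_append.1 hs).elim (hT s) (hT' s), by simp [hne], ?_⟩
    rw [List.map_append]
    exact (AC.union hσ hτ).trans (unionList_append (by simpa using hne) (by simpa using hne')).symm

end InnerIrreducible

/-- No type equal to `σ` modulo commutativity and associativity contains a redex. -/
structure Irreducible (σ : Ty A) : Prop where
  inner : InnerIrreducible σ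
  dist : ∀ (C : Ctx A) (a b c : Ty A), C.TopLevel → ¬ AC σ (C.fill (.union (.inter a b) c))

namespace Irreducible

variable {σ τ : Ty A}

theorem of_not_step (h : ∀ r, ¬ Step σ.cls r) : Irreducible σ where
  inner C _ t hs hi := h (C.fill t).cls ⟨_, _, cls_eq.2 hs.symm, rfl, .ctx C hi⟩
  dist C a b c hC hs := h _ ⟨_, _, cls_eq.2 hs.symm, rfl, .dist C a b c hC⟩

theorem inter_left (h : Irreducible (.inter σ τ)) : Irreducible σ :=
  ⟨h.inner.inter_left, fun C a b c hC hs =>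
    h.dist (.interL C τ) a b c hC (.inter hs (.refl τ))⟩

theorem inter_right (h : Irreducible (.inter σ τ)) : Irreducible τ :=
  ⟨h.inner.inter_right, fun C a b c hC hs =>
    h.dist (.interR σ C) a b c hC (.inter (.refl σ) hs)⟩

theorem interFree_of_union (h : Irreducible (.union σ τ)) : (Ty.union σ τ).InterFree := by
  refine ⟨?_, ?_⟩
  · by_contra hn
    obtain ⟨a, b, h' | ⟨c, h'⟩⟩ := exists_inter_of_not_interFree hn
    · exact h.dist .hole a b τ trivial (.union h' (.refl τ))
    · exact h.dist (.unionL .hole τ) a b c trivial (.union h' (.refl τ))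
  · by_contra hn
    obtain ⟨a, b, h' | ⟨c, h'⟩⟩ := exists_inter_of_not_interFree hn
    · exact h.dist .hole a b σ trivial ((AC.union_comm _ _).trans (.union h' (.refl σ)))
    · exact h.dist (.unionR σ .hole) a b c trivial (.union (.refl σ) h')

theorem exists_clauses (h : Irreducible σ) :
    ∃ X : List (List (Factor A)), (∀ C ∈ X, NormalClause C) ∧
      AC σ (interList (X.map clauseTy)) := by
  have single {σ : Ty A} (h : Irreducible σ) (hf : σ.InterFree) (hω : ¬ AC σ .omega) :
      ∃ X : List (List (Factor A)), (∀ C ∈ X, NormalClause C) ∧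
        AC σ (interList (X.map clauseTy)) := by
    obtain ⟨T, hT, hne, hσ⟩ := h.inner.exists_factors.2 hf hω
    exact ⟨[T], by simpa using ⟨hT, hne, h.inner.irredundant_union hσ⟩, hσ⟩
  -- A type equivalent to `ω` and distinct from it is a redex.
  have key {σ : Ty A} (h : Irreducible σ) (hne : σ ≠ .omega) : ¬ AC σ .omega := fun h' =>
    h.inner .hole σ _ (.refl σ) (.omega h'.le_and_ge.2 hne)
  induction σ with
  | omega => exact ⟨[], by simp, .refl _⟩
  | atom a => exact single h trivial (key h (by simp))
  | arrow σ τ => exact single h trivial (key h (by simp))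
  | union σ τ => exact single h h.interFree_of_union (key h (by simp))
  | inter σ τ ihσ ihτ =>
    obtain ⟨X, hX, hσ⟩ := ihσ h.inter_left
    obtain ⟨Y, hY, hτ⟩ := ihτ h.inter_right
    have hne : X ≠ [] := by rintro rfl; exact h.inner.not_omega_of_inter.1 hσ
    have hne' : Y ≠ [] := by rintro rfl; exact h.inner.not_omega_of_inter.2 hτ
    refine ⟨X ++ Y, fun C hC => (List.mem_append.1 hC).elim (hX C) (hY C), ?_⟩
    rw [List.map_append]
    exact (AC.inter hσ hτ).trans (interList_append (by simpa using hne) (by simpa using hne')).symm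

/-- Equivalent irreducible types are equal modulo commutativity and associativity. -/
theorem cls_eq (hσ : Irreducible σ) (hτ : Irreducible τ) (h : Equivalent σ τ) :
    σ.cls = τ.cls := by
  obtain ⟨X, hX, hσX⟩ := hσ.exists_clauses
  obtain ⟨Y, hY, hτY⟩ := hτ.exists_clauses
  rw [IUTypes.cls_eq.2 hσX, IUTypes.cls_eq.2 hτY]
  exact NormalCnf.cls_eq ⟨hX, hσ.inner.irredundant_inter hσX⟩ ⟨hY, hτ.inner.irredundant_inter hτY⟩
    (hσX.equivalent.symm.trans (h.trans hτY.equivalent))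

end Irreducible

/-! ### Uniqueness of normal forms -/

theorem IsNF.eq_of_equivalent {σ τ : Ty A} {p q : TyAC A} (hp : IsNF σ p) (hq : IsNF τ q)
    (h : Equivalent σ τ) : p = q := by
  obtain ⟨σ', rfl, hσ⟩ := hp.exists_equivalent
  obtain ⟨τ', rfl, hτ⟩ := hq.exists_equivalent
  exact (Irreducible.of_not_step hp.2).cls_eq (.of_not_step hq.2)
    (hσ.symm.trans (h.trans hτ))

theorem isNF_nf (σ : Ty A) : IsNF σ (nf σ) :=
  @Classical.epsilon_spec_aux _ ⟨σ.cls⟩ _ (exists_isNF σ)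

theorem Equivalent.nf_eq {σ τ : Ty A} (h : Equivalent σ τ) : nf σ = nf τ :=
  (isNF_nf σ).eq_of_equivalent (isNF_nf τ) h

/-- The number of occurrences of atoms outside the domains of arrows, with `none` as the value of
`ω`, neutral for intersection and absorbing for union. It is invariant under semantic
equivalence. -/
def atomCount : Ty A → Option ℕ
  | .atom _ => some 1
  | .omega => none
  | .arrow _ τ => atomCount τ
  | .inter σ τ =>
    match atomCount σ, atomCount τ with
    | none, n => n
    | some m, none => some m
    | some m, some n => some (m + n)
  | .union σ τ =>
    match atomCount σ, atomCount τ with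
    | some m, some n => some (m + n)
    | _, _ => none

theorem SemEq.atomCount_eq {σ τ : Ty A} (h : SemEq σ τ) : atomCount σ = atomCount τ := by
  induction h with
  | refl => rfl
  | symm _ ih => exact ih.symm
  | trans _ _ h₁ h₂ => exact h₁.trans h₂
  | arrow _ _ _ h => exact h
  | inter _ _ h₁ h₂ | union _ _ h₁ h₂ => simp only [atomCount, h₁, h₂]
  | atom_eq | omega_eq => rfl
  | inter_omega σ | omega_inter σ | union_omega σ | omega_union σ =>
    cases h : atomCount σ <;> simp [atomCount, h]

theorem equivalent_inter_self (σ : Ty A) : Equivalent (.inter σ σ) σ := fun U _ => by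
  rw [holds_inter, and_self]

theorem not_semEq_inter_self (a : A) : ¬ SemEq (.inter (.atom a) (.atom a)) (.atom a) := fun h => by
  simpa [atomCount] using h.atomCount_eq

end IUTypes

theorem mainTheorem10 (A : Type*) [Countable A] [Infinite A] :
    (∀ σ : IUTypes.Ty A, ∃! q : IUTypes.TyAC A, IUTypes.IsNF σ q) ∧
    (∀ σ τ : IUTypes.Ty A, IUTypes.SemEq σ τ → IUTypes.nf σ = IUTypes.nf τ) ∧
    (∃ σ τ : IUTypes.Ty A, IUTypes.nf σ = IUTypes.nf τ ∧ ¬ IUTypes.SemEq σ τ) := by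
  refine ⟨fun σ => ?_, fun σ τ h => h.equivalent.nf_eq, ?_⟩
  · obtain ⟨q, hq⟩ := IUTypes.exists_isNF σ
    exact ⟨q, hq, fun p hp => hp.eq_of_equivalent hq (.refl σ)⟩
  · let a : A := Classical.arbitrary A
    exact ⟨.inter (.atom a) (.atom a), .atom a, (IUTypes.equivalent_inter_self _).nf_eq,
      IUTypes.not_semEq_inter_self a⟩
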